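/- **Setting.** Identify $\mathbb R^n$ with its dual through the standard inner product. For a set $T\subset\mathbb R^n$ write $\|v\|_T=\max_{p\in T}\langle p,v\rangle$, and let $K^\circ=\{p:\langle p,q\rangle\le 1\ \text{for all } q\in K\}$ be the polar of $K$. *Hanner polytopes* are defined inductively: the segment $[-1,1]\subset\mathbb R^1$ is a Hanner polytope; and if $K\subset\mathbb R^k$ and $L\subset\mathbb R^l$ are Hanner polytopes, which are the unit balls of norms $N_K$ and $N_L$, then the unit balls in $\mathbb R^{k+l}=\mathbb R^k\oplus\mathbb R^l$ of the norms $N_K(x)+N_L(y)$ and $\max\{N_K(x),N_L(y)\}$ are Hanner polytopes. For a Hanner polytope $K$, a point $q\in\partial K$ lies in the smooth piece of $\partial K$ if the norm $\|\cdot\|_{K^\circ}$ (whose unit ball is $K$) is differentiable at $q$; the outer normal is then $n_K(q)=d\|q\|_{K^\circ}$, the differential of that norm at $q$. Note that the polar of a Hanner polytope is a Hanner polytope. Let $H\subset\mathbb R^n$ be a Hanner polytope. A *(closed) classical billiard trajectory in $H$ with geometry specified by $H^\circ$* consists of points $q_i$ in the smooth piece of $\partial H$ and momenta $p_i$ in the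 smooth piece of $\partial H^\circ$, with indices $i\in\mathbb Z/m$, $m\ge1$, such that for every $i$ $$p_{i+1}-p_i=-\lambda_i\, n_H(q_i),\qquad q_{i+1}-q_i=\mu_i\, n_{H^\circ}(p_{i+1})\qquad\text{with some }\lambda_i>0,\ \mu_i>0 .$$ It bounces $m$ times, and its length is $\sum_{i\in\mathbb Z/m}\|q_{i+1}-q_i\|_{H^\circ}$. It is *simple* if it does not pass the same route several times, i.e. there is no $d\not\equiv 0 \pmod m$ with $q_{i+d}=q_i$ and $p_{i+d}=p_i$ for all $i$. **Theorem.** Let $H\subset\mathbb R^n$ be a Hanner polytope. Every simple classical billiard trajectory in $H$ with geometry specified by $H^\circ$ 1. has length $4$; 2. bounces exactly $2n$ times, i.e. $m=2n$; 3. is centrally symmetric with respect to the origin, and so is the corresponding momentum trajectory: $q_i=-q_{i+n}$ and $p_i=-p_{i+n}$ for all $i$ (indices modulo $m=2n$). -/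

import Mathlib

namespace HannerBilliard

noncomputable section

/-- The space `ℝⁿ`. It is identified with its dual space through the standard inner product. -/
abbrev Space (n : ℕ) : Type := EuclideanSpace ℝ (Fin n)

/-- The polar body `K° = {p | ⟨p, q⟩ ≤ 1 for all q ∈ K}`. -/
def polarBody {n : ℕ} (K : Set (Space n)) : Set (Space n) :=
  {p | ∀ q ∈ K, inner ℝ p q ≤ 1}

/-- `‖q‖_T = max_{p ∈ T} ⟨p, q⟩`, the norm whose unit ball is the polar of `T`. -/
def bodyNorm {n : ℕ} (T : Set (Space n)) (q : Space n) : ℝ :=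
  sSup ((fun p : Space n => (inner ℝ p q : ℝ)) '' T)

/-- `q` lies in the smooth piece of the boundary of `K`, and `ν = n_K(q)` is the outer normal there:
the differential at `q` of the norm `‖·‖_{K°}`, whose unit body is `K`. -/
def IsSmoothBoundaryPointWithNormal {n : ℕ} (K : Set (Space n)) (q ν : Space n) : Prop :=
  q ∈ frontier K ∧ HasGradientAt (bodyNorm (polarBody K)) ν q

/-- The first `k` coordinates of a vector of `ℝᵏ⁺ˡ`. -/
def firstPart {k l : ℕ} (x : Space (k + l)) : Space k :=
  WithLp.toLp 2 fun i => x (Fin.castAdd l i)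

/-- The last `l` coordinates of a vector of `ℝᵏ⁺ˡ`. -/
def lastPart {k l : ℕ} (x : Space (k + l)) : Space l :=
  WithLp.toLp 2 fun i => x (Fin.natAdd k i)

/-- `K ⊕₁ L`: the unit body of the sum of the norms with unit bodies `K` and `L`. -/
def sumOne {k l : ℕ} (K : Set (Space k)) (L : Set (Space l)) : Set (Space (k + l)) :=
  {x | gauge K (firstPart x) + gauge L (lastPart x) ≤ 1}

/-- `K ⊕_∞ L`: the unit body of the maximum of the norms with unit bodies `K` and `L`. -/
def sumInfty {k l : ℕ} (K : Set (Space k)) (L : Set (Space l)) : Set (Space (k + l)) :=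
  {x | max (gauge K (firstPart x)) (gauge L (lastPart x)) ≤ 1}

/-- Hanner polytopes: obtained from the segment `[-1, 1] ⊂ ℝ¹` by `ℓ₁`- and `ℓ_∞`-sums. -/
inductive IsHanner : {n : ℕ} → Set (Space n) → Prop
  | segment : IsHanner {x : Space 1 | x 0 ∈ Set.Icc (-1 : ℝ) 1}
  | sumOne {k l : ℕ} {K : Set (Space k)} {L : Set (Space l)} :
      IsHanner K → IsHanner L → IsHanner (sumOne K L)
  | sumInfty {k l : ℕ} {K : Set (Space k)} {L : Set (Space l)} :
      IsHanner K → IsHanner L → IsHanner (sumInfty K L)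

/-- Closed classical billiard trajectories with `m` bounces in the body `K`, with geometry given
by the body `T`. The points `q i` are the consecutive bounce points (indices modulo `m`) and `p i`
is the momentum on the segment that arrives at `q i`, so `p (i + 1)` is the one on the segment from
`q i` to `q (i + 1)`. All coordinates and momenta lie in the smooth pieces of the boundaries.
At each bounce `p' - p = -λ n_K(q)` with `λ > 0`, and between bounces the point moves in the
direction of the velocity `d‖p‖_{T°} = n_T(p)`. -/
structure IsClassicalTrajectory {n m : ℕ} (K T : Set (Space n)) (q p : ZMod m → Space n) :
    Prop where
  momentum_step : ∀ i, ∃ ν : Space n, IsSmoothBoundaryPointWithNormal K (q i) ν ∧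
    ∃ c : ℝ, 0 < c ∧ p (i + 1) - p i = -(c • ν)
  coordinate_step : ∀ i, ∃ v : Space n, IsSmoothBoundaryPointWithNormal T (p (i + 1)) v ∧
    ∃ c : ℝ, 0 < c ∧ q (i + 1) - q i = c • v

/-- A closed trajectory is simple if it does not pass the same route several times: no nontrivial
cyclic shift of the indices maps it (coordinates and momenta) to itself. -/
def IsSimpleTrajectory {n m : ℕ} (q p : ZMod m → Space n) : Prop :=
  ∀ d : ZMod m, (∀ i, q (i + d) = q i ∧ p (i + d) = p i) → d = 0

/-- The length `∑ᵢ ‖q_{i+1} - q_i‖_T` of the closed polygonal line with vertices `q i`. -/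
def trajectoryLength {n m : ℕ} [NeZero m] (T : Set (Space n)) (q : ZMod m → Space n) : ℝ :=
  ∑ i : ZMod m, bodyNorm T (q (i + 1) - q i)

end

end HannerBilliard

/-!
Run a trajectory at unit speed. By induction over the sums that build up the polytope, every closed
trajectory, simple or not, is reflected in the origin, together with its momenta, after time `2` and
`n` bounces. It thus runs around a route of length `4` with `2n` bounces, and if it is simple, it
does so only once.

Exchanging coordinates with momenta turns a trajectory in `H` with geometry `H°` into one in `H°`
with geometry `H` with the same bounces and the same length, so it suffices to treat `ℓ_∞`-sums. The
unit ball of an `ℓ_∞`-sum is the product of two unit balls, and at a smooth boundary point its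
normal lies in one of the two summands, while the velocity has norm `1` in both. Hence both
projections of a trajectory are billiard orbits that run at unit speed, and each bounce of the
trajectory is a bounce of exactly one projection. By induction both projections are reflected in the
origin after the time `2`, and the numbers of their bounces in this time add up to `n`.
-/

namespace HannerBilliard

open Function
open scoped AddConstMap

section DualPair

variable {E F : Type*} [NormedAddCommGroup E] [InnerProductSpace ℝ E] [NormedAddCommGroup F]
  [InnerProductSpace ℝ F] {N N' : Seminorm ℝ E} {p q ν : E}

/-- A dual pair of norms on a nonzero space identified with its dual by the inner product: each of
the two norms is the support function of the unit ball of the other. -/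
structure IsDualPair (N N' : Seminorm ℝ E) : Prop where
  nontrivial : Nontrivial E
  inner_le : ∀ p q : E, inner ℝ p q ≤ N' p * N q
  exists_inner_eq : ∀ q : E, ∃ p : E, N' p ≤ 1 ∧ inner ℝ p q = N q
  exists_inner_eq' : ∀ p : E, ∃ q : E, N q ≤ 1 ∧ inner ℝ q p = N' p

/-- `ν` is the only point of the unit ball of `N'` that norms `q`. For a dual pair of norms this
says that `N` is differentiable at `q` with gradient `ν`, in a form which avoids derivatives. -/
structure IsNormal (N N' : Seminorm ℝ E) (q ν : E) : Prop where
  le_one : N' ν ≤ 1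
  inner_eq : inner ℝ ν q = N q
  unique : ∀ g, N' g ≤ 1 → inner ℝ g q = N q → g = ν

namespace IsDualPair

theorem symm (h : IsDualPair N N') : IsDualPair N' N where
  nontrivial := h.nontrivial
  inner_le p q := by rw [real_inner_comm, mul_comm]; exact h.inner_le q p
  exists_inner_eq := h.exists_inner_eq'
  exists_inner_eq' := h.exists_inner_eq

theorem inner_le_of_le_one (h : IsDualPair N N') (hp : N' p ≤ 1) (q : E) : inner ℝ p q ≤ N q :=
  (h.inner_le p q).trans (mul_le_of_le_one_left (apply_nonneg N q) hp)

theorem pos (h : IsDualPair N N') (hq : q ≠ 0) : 0 < N q :=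
  pos_of_mul_pos_right ((real_inner_self_pos.2 hq).trans_le (h.inner_le q q)) (apply_nonneg N' q)

theorem exists_ne_zero (h : IsDualPair N N') : ∃ p : E, p ≠ 0 ∧ N' p ≤ 1 := by
  have := h.nontrivial
  obtain ⟨w, hw⟩ := exists_ne (0 : E)
  obtain ⟨p, hp, hpw⟩ := h.exists_inner_eq w
  refine ⟨p, ?_, hp⟩
  rintro rfl
  exact (h.pos hw).ne ((inner_zero_left w).symm.trans hpw)

theorem isNormal_of_hasGradientAt [CompleteSpace E] (h : IsDualPair N N')
    (hν : HasGradientAt N ν q) : IsNormal N N' q ν := by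
  have unique : ∀ g : E, N' g ≤ 1 → inner ℝ g q = N q → g = ν := fun g hg hgq => by
    have hmin : IsLocalMin (fun x => N x - innerSL ℝ g x) q := .of_forall fun x => by
      simpa [hgq] using h.inner_le_of_le_one hg x
    have hderiv := hmin.hasFDerivAt_eq_zero (hν.hasFDerivAt.sub (innerSL ℝ g).hasFDerivAt)
    refine ext_inner_right ℝ fun w => ?_
    simpa using (DFunLike.congr_fun (sub_eq_zero.1 hderiv) w).symm
  obtain ⟨g, hg, hgq⟩ := h.exists_inner_eq q
  obtain rfl := unique g hg hgq
  exact ⟨hg, hgq, unique⟩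

end IsDualPair

namespace IsNormal

theorem eq {ν' : E} (h : IsNormal N N' q ν) (h' : IsNormal N N' q ν') : ν = ν' :=
  h'.unique _ h.le_one h.inner_eq

theorem neg (h : IsNormal N N' q ν) : IsNormal N N' (-q) (-ν) where
  le_one := by rw [map_neg_eq_map]; exact h.le_one
  inner_eq := by rw [inner_neg_neg, map_neg_eq_map]; exact h.inner_eq
  unique g hg hgq := by
    rw [← h.unique (-g) (by rwa [map_neg_eq_map])
      (by rw [inner_neg_left, ← inner_neg_right, hgq, map_neg_eq_map]), neg_neg]

theorem smul (h : IsNormal N N' q ν) {c : ℝ} (hc : 0 < c) : IsNormal N N' (c • q) ν where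
  le_one := h.le_one
  inner_eq := by rw [inner_smul_right, h.inner_eq, map_smul_eq_mul, Real.norm_of_nonneg hc.le]
  unique g hg hgq := by
    rw [inner_smul_right, map_smul_eq_mul, Real.norm_of_nonneg hc.le] at hgq
    exact h.unique g hg (mul_left_cancel₀ hc.ne' hgq)

theorem pos (h : IsNormal N N' q ν) (hd : IsDualPair N N') : 0 < N q := by
  refine hd.pos ?_
  rintro rfl
  obtain ⟨p, hp, hp_le⟩ := hd.exists_ne_zero
  exact hp ((h.unique p hp_le (by simp)).trans (h.unique 0 (by simp) (by simp)).symm)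

theorem eq_one (h : IsNormal N N' q ν) (hd : IsDualPair N N') : N' ν = 1 := by
  have hle := hd.inner_le ν q
  rw [h.inner_eq] at hle
  exact h.le_one.antisymm (le_of_mul_le_mul_right (by rwa [one_mul]) (h.pos hd))

theorem ne_zero (h : IsNormal N N' q ν) (hd : IsDualPair N N') : ν ≠ 0 := by
  rintro rfl
  simpa using h.eq_one hd

theorem exists_eq_of_injective (h : IsNormal N N' q ν) {M M' : Seminorm ℝ F}
    (hM : IsDualPair M M') {f : F → E} (hf : Injective f) (hf_le : ∀ g, M' g ≤ 1 → N' (f g) ≤ 1)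
    {x : F} (hf_inner : ∀ g, inner ℝ (f g) q = inner ℝ g x) (hx : M x = N q) :
    ∃ g, IsNormal M M' x g ∧ f g = ν := by
  have hν : ∀ g, M' g ≤ 1 → inner ℝ g x = M x → f g = ν := fun g hg hgx =>
    h.unique _ (hf_le g hg) (by rw [hf_inner, hgx, hx])
  obtain ⟨g, hg, hgx⟩ := hM.exists_inner_eq x
  exact ⟨g, ⟨hg, hgx, fun g' hg' hgx' => hf ((hν g' hg' hgx').trans (hν g hg hgx).symm)⟩,
    hν g hg hgx⟩

end IsNormal

end DualPair

section Orbits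

variable {E : Type*} [NormedAddCommGroup E] [InnerProductSpace ℝ E] {N N' : Seminorm ℝ E}
  {q p : ℕ → E} {τ : ℕ → ℝ} {m n : ℕ} {T : ℝ}

/-- Periodic billiard orbits in the unit ball of `N` observed at the times `τ i`: at the time `τ i`
the orbit arrives at `q i` with the momentum `p i`. Every bounce is observed, but observations
inside the ball are allowed too; the summands of an orbit in a product of balls are of this kind.
The norm `N'` of the momentum is constant but arbitrary. -/
structure IsBilliardOrbit (N N' : Seminorm ℝ E) (q p : ℕ → E) (τ : ℕ → ℝ) (m : ℕ) (T : ℝ) :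
    Prop where
  strictMono : StrictMono τ
  period_pos : 0 < m
  periodic_q : Periodic q m
  periodic_p : Periodic p m
  time_add_period : ∀ i, τ (i + m) = τ i + T
  energy : ∀ i, N' (p (i + 1)) = N' (p i)
  move : ∀ i, ∃ v, IsNormal N' N (p (i + 1)) v ∧ q (i + 1) - q i = (τ (i + 1) - τ i) • v
  kick : ∀ i, N (q i) = 1 →
    ∃ ν, IsNormal N N' (q i) ν ∧ ∃ c : ℝ, 0 < c ∧ p (i + 1) - p i = -(c • ν)
  free : ∀ i, N (q i) ≠ 1 → p (i + 1) = p i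

/-- Periodic billiard orbits with momenta on the unit sphere that are observed exactly at their
bounces. -/
structure IsBounceOrbit (N N' : Seminorm ℝ E) (q p : ℕ → E) (τ : ℕ → ℝ) (m : ℕ) (T : ℝ) : Prop
    extends IsBilliardOrbit N N' q p τ m T where
  norm_q : ∀ i, N (q i) = 1
  norm_p : ∀ i, N' (p i) = 1

/-- An orbit turns into its mirror image in the origin after `n` observations, which take the
time `2`, and its period is a multiple of `4`. -/
structure IsCentrallySymmetric (n : ℕ) (q p : ℕ → E) (τ : ℕ → ℝ) (T : ℝ) : Prop where
  antiperiodic_q : Antiperiodic q n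
  antiperiodic_p : Antiperiodic p n
  time_add : ∀ i, τ (i + n) = τ i + 2
  exists_period_eq : ∃ r : ℕ, T = 4 * r

/-- All billiard orbits in the unit ball of `N` are centrally symmetric with `n` bounces in each
half. This is the property of Hanner polytopes that is proved by induction. -/
def IsRigid (n : ℕ) (N N' : Seminorm ℝ E) : Prop :=
  ∀ (q p : ℕ → E) (τ : ℕ → ℝ) (m : ℕ) (T : ℝ),
    IsBounceOrbit N N' q p τ m T → IsCentrallySymmetric n q p τ T

theorem IsBounceOrbit.exists_eq_mul (ho : IsBounceOrbit N N' q p τ m T)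
    (hs : IsCentrallySymmetric n q p τ T) : ∃ r : ℕ, m = 2 * n * r ∧ T = 4 * r := by
  obtain ⟨r, rfl⟩ := hs.exists_period_eq
  have htime : τ (0 + (2 * r) • n) = τ 0 + (2 * r) • 2 :=
    AddConstMapClass.map_add_nsmul (⟨τ, hs.time_add⟩ : ℕ →+c[n, 2] ℝ) 0 (2 * r)
  refine ⟨r, ho.strictMono.injective ?_, rfl⟩
  have hperiod := ho.time_add_period 0
  rw [zero_add] at htime hperiod
  rw [hperiod, mul_right_comm, ← smul_eq_mul (2 * r) n, htime, nsmul_eq_mul]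
  push_cast
  ring

/-- The action `⟨p, q⟩` accounts for the difference between the clocks of the two orbits. -/
theorem IsBounceOrbit.dual (ho : IsBounceOrbit N N' q p τ m T) :
    IsBounceOrbit N' N (fun i => p (i + 1)) (fun i => -q i)
      (fun i => τ i - inner ℝ (p (i + 1)) (q i)) m T := by
  have hstep : ∀ i, ∃ ν, IsNormal N N' (q (i + 1)) ν ∧ ∃ c : ℝ, 0 < c ∧
      p (i + 1 + 1) - p (i + 1) = -(c • ν) ∧
      τ (i + 1) - inner ℝ (p (i + 1 + 1)) (q (i + 1)) - (τ i - inner ℝ (p (i + 1)) (q i)) = c := by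
    intro i
    obtain ⟨v, hv, hq⟩ := ho.move i
    obtain ⟨ν, hν, c, hc, hp⟩ := ho.kick (i + 1) (ho.norm_q _)
    have hv_inner : inner ℝ (p (i + 1)) v = 1 := by
      rw [real_inner_comm, hv.inner_eq, ho.norm_p]
    have hτ := congrArg (inner ℝ (p (i + 1))) hq
    have hc' := congrArg (inner ℝ · (q (i + 1))) hp
    simp only [inner_sub_right, inner_smul_right, hv_inner] at hτ
    simp only [inner_sub_left, inner_neg_left, real_inner_smul_left, hν.inner_eq, ho.norm_q] at hc'
    exact ⟨ν, hν, c, hc, hp, by linarith⟩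
  refine ⟨⟨strictMono_nat_of_lt_succ fun i => ?_, ho.period_pos, fun i => ?_, fun i => ?_,
    fun i => ?_, fun i => ?_, fun i => ?_, fun i _ => ?_, fun i hi => (hi (ho.norm_p _)).elim⟩,
    fun i => ho.norm_p _, fun i => ?_⟩
  · obtain ⟨-, -, c, hc, -, hτ⟩ := hstep i
    linarith
  · rw [add_right_comm, ho.periodic_p]
  · rw [ho.periodic_q]
  · rw [add_right_comm, ho.periodic_p, ho.periodic_q, ho.time_add_period]
    ring
  · simp only [map_neg_eq_map, ho.norm_q]
  · obtain ⟨ν, hν, c, -, hp, hτ⟩ := hstep i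
    exact ⟨-ν, hν.neg, by rw [hτ, hp, smul_neg]⟩
  · obtain ⟨v, hv, hq⟩ := ho.move i
    exact ⟨v, hv, _, sub_pos.2 (ho.strictMono i.lt_succ_self), by rw [← hq]; abel⟩
  · rw [map_neg_eq_map, ho.norm_q]

theorem IsRigid.symm (hr : IsRigid n N N') : IsRigid n N' N := by
  intro q p τ m T ho
  obtain ⟨hp, hq, hτ, hT⟩ := hr _ _ _ _ _ ho.dual
  have hq : Antiperiodic q n := fun i => neg_injective (hq i)
  have hp_succ : ∀ i, p (i + n + 1) = -p (i + 1) := hp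
  refine ⟨hq, fun i => ?_, fun i => ?_, hT⟩
  · obtain ⟨a, ha⟩ := Nat.exists_eq_add_of_lt ho.period_pos
    have := hp_succ (i + a)
    rwa [show i + a + n + 1 = i + n + m by lia, show i + a + 1 = i + m by lia,
      ho.periodic_p, ho.periodic_p] at this
  · have := hτ i
    rw [hp_succ, hq i, inner_neg_neg] at this
    linarith

namespace IsBilliardOrbit

theorem norm_p_eq (ho : IsBilliardOrbit N N' q p τ m T) (i : ℕ) : N' (p i) = N' (p 0) := by
  induction i with
  | zero => rfl
  | succ i ih => rw [ho.energy, ih]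

theorem smul_momentum (ho : IsBilliardOrbit N N' q p τ m T) {a : ℝ} (ha : 0 < a) :
    IsBilliardOrbit N N' q (a • p) τ m T where
  strictMono := ho.strictMono
  period_pos := ho.period_pos
  periodic_q := ho.periodic_q
  periodic_p := ho.periodic_p.smul a
  time_add_period := ho.time_add_period
  energy i := by simp only [Pi.smul_apply, map_smul_eq_mul, ho.energy]
  move i := by
    obtain ⟨v, hv, hq⟩ := ho.move i
    exact ⟨v, hv.smul ha, hq⟩
  kick i hi := by
    obtain ⟨ν, hν, c, hc, hp⟩ := ho.kick i hi
    exact ⟨ν, hν, a * c, mul_pos ha hc, by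
      rw [Pi.smul_apply, Pi.smul_apply, ← smul_sub, hp, smul_neg, smul_smul]⟩
  free i hi := by rw [Pi.smul_apply, Pi.smul_apply, ho.free i hi]

theorem eq_of_forall_between (ho : IsBilliardOrbit N N' q p τ m T) {i j : ℕ} (hij : i < j)
    (hfree : ∀ a, i < a → a < j → N (q a) ≠ 1) {v : E} (hv : IsNormal N' N (p (i + 1)) v) :
    p j = p (i + 1) ∧ q j = q i + (τ j - τ i) • v := by
  induction j, hij using Nat.le_induction with
  | base =>
    obtain ⟨w, hw, hq⟩ := ho.move i
    obtain rfl := hw.eq hv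
    exact ⟨rfl, sub_eq_iff_eq_add'.1 hq⟩
  | succ j hij ih =>
    obtain ⟨hpj, hqj⟩ := ih fun a hia haj => hfree a hia (haj.trans j.lt_succ_self)
    have hp : p (j + 1) = p (i + 1) := (ho.free j (hfree j hij j.lt_succ_self)).trans hpj
    obtain ⟨w, hw, hq⟩ := ho.move j
    rw [hp] at hw
    obtain rfl := hw.eq hv
    refine ⟨hp, ?_⟩
    rw [sub_eq_iff_eq_add'.1 hq, hqj]
    module

theorem exists_bounce (hd : IsDualPair N N') (ho : IsBilliardOrbit N N' q p τ m T) :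
    ∃ i, N (q i) = 1 := by
  by_contra! hfree
  obtain ⟨v, hv, -⟩ := ho.move 0
  have hq := (ho.eq_of_forall_between ho.period_pos (fun a _ _ => hfree a) hv).2
  rw [← zero_add m, ho.periodic_q, left_eq_add, zero_add] at hq
  exact smul_ne_zero (sub_pos.2 (ho.strictMono ho.period_pos)).ne' (hv.ne_zero hd.symm) hq

theorem infinite_bounces (hd : IsDualPair N N') (ho : IsBilliardOrbit N N' q p τ m T) :
    {i | N (q i) = 1}.Infinite := by
  obtain ⟨i, hi⟩ := ho.exists_bounce hd
  refine Set.infinite_of_forall_exists_gt fun b => ⟨i + (b + 1) * m, ?_, ?_⟩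
  · rwa [Set.mem_ofPred_eq, ← smul_eq_mul, ho.periodic_q.nsmul]
  · nlinarith [ho.period_pos]

end IsBilliardOrbit

/-- The number of bounces before the observation `i`. -/
noncomputable def bounceCount (N : Seminorm ℝ E) (q : ℕ → E) (i : ℕ) : ℕ :=
  Nat.count (fun a => N (q a) = 1) i

/-- The index of the observation of the bounce number `j`, counted from `0`. It is a junk value
when there are at most `j` bounces. -/
noncomputable def bounceIndex (N : Seminorm ℝ E) (q : ℕ → E) (j : ℕ) : ℕ :=
  Nat.nth (fun a => N (q a) = 1) j

theorem bounceCount_succ (i : ℕ) :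
    bounceCount N q (i + 1) = bounceCount N q i + if N (q i) = 1 then 1 else 0 :=
  Nat.count_succ _ _

theorem bounceIndex_bounceCount {i : ℕ} (hi : N (q i) = 1) :
    bounceIndex N q (bounceCount N q i) = i :=
  Nat.nth_count (p := fun a => N (q a) = 1) hi

theorem bounceCount_add_period (hq : Periodic q m) (i : ℕ) :
    bounceCount N q (i + m) = bounceCount N q i + bounceCount N q m := by
  rw [bounceCount, Nat.count_add']
  simp only [hq _]
  rfl

namespace IsBilliardOrbit

variable (hd : IsDualPair N N') (ho : IsBilliardOrbit N N' q p τ m T)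
include hd ho

theorem bounceIndex_strictMono : StrictMono (bounceIndex N q) :=
  Nat.nth_strictMono (ho.infinite_bounces hd)

theorem norm_bounceIndex (j : ℕ) : N (q (bounceIndex N q j)) = 1 :=
  Nat.nth_mem_of_infinite (ho.infinite_bounces hd) j

theorem bounceCount_bounceIndex (j : ℕ) : bounceCount N q (bounceIndex N q j) = j :=
  Nat.count_nth_of_infinite (ho.infinite_bounces hd) j

theorem bounceCount_eq_succ_iff {i j : ℕ} :
    bounceCount N q i = j + 1 ↔ bounceIndex N q j < i ∧ i ≤ bounceIndex N q (j + 1) := by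
  have hinf := ho.infinite_bounces hd
  rw [bounceIndex, bounceIndex, ← Nat.lt_nth_iff_count_lt hinf, ← Nat.count_le_iff_le_nth hinf]
  exact ⟨fun h => ⟨h.ge, h.le⟩, fun h => h.2.antisymm h.1⟩

theorem bounceIndex_add_period (j : ℕ) :
    bounceIndex N q (j + bounceCount N q m) = bounceIndex N q j + m := by
  have h := bounceIndex_bounceCount (N := N) (q := q) (i := bounceIndex N q j + m)
    (by rw [ho.periodic_q, ho.norm_bounceIndex hd])
  rwa [bounceCount_add_period ho.periodic_q, ho.bounceCount_bounceIndex hd] at h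

theorem bounceCount_period_pos : 0 < bounceCount N q m := by
  refine Nat.pos_of_ne_zero fun h => ho.period_pos.ne' ?_
  simpa only [h, add_zero, left_eq_add] using ho.bounceIndex_add_period hd 0

theorem exists_eq_of_bounceCount_eq_succ (j : ℕ) :
    ∃ v, IsNormal N' N (p (bounceIndex N q (j + 1))) v ∧ ∀ i, bounceCount N q i = j + 1 →
      p i = p (bounceIndex N q (j + 1)) ∧
      q i = q (bounceIndex N q j) + (τ i - τ (bounceIndex N q j)) • v := by
  obtain ⟨v, hv, -⟩ := ho.move (bounceIndex N q j)
  have hflight : ∀ i, bounceCount N q i = j + 1 → p i = p (bounceIndex N q j + 1) ∧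
      q i = q (bounceIndex N q j) + (τ i - τ (bounceIndex N q j)) • v := fun i hi => by
    obtain ⟨hj, hj_succ⟩ := (ho.bounceCount_eq_succ_iff hd).1 hi
    refine ho.eq_of_forall_between hj (fun a hja hai ha => ?_) hv
    exact (Nat.le_nth_of_lt_nth_succ (hai.trans_le hj_succ) ha).not_gt hja
  have hp := (hflight _ (ho.bounceCount_bounceIndex hd (j + 1))).1
  rw [← hp] at hv hflight
  exact ⟨v, hv, hflight⟩

theorem isBounceOrbit_comp_bounceIndex (hp : N' (p 0) = 1) :
    IsBounceOrbit N N' (q ∘ bounceIndex N q) (p ∘ bounceIndex N q) (τ ∘ bounceIndex N q)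
      (bounceCount N q m) T where
  strictMono := ho.strictMono.comp (ho.bounceIndex_strictMono hd)
  period_pos := ho.bounceCount_period_pos hd
  periodic_q j := by rw [comp_apply, ho.bounceIndex_add_period hd, ho.periodic_q, comp_apply]
  periodic_p j := by rw [comp_apply, ho.bounceIndex_add_period hd, ho.periodic_p, comp_apply]
  time_add_period j := by
    rw [comp_apply, ho.bounceIndex_add_period hd, ho.time_add_period, comp_apply]
  energy j := (ho.norm_p_eq _).trans (ho.norm_p_eq _).symm
  move j := by
    obtain ⟨v, hv, hflight⟩ := ho.exists_eq_of_bounceCount_eq_succ hd j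
    exact ⟨v, hv, sub_eq_iff_eq_add'.2 (hflight _ (ho.bounceCount_bounceIndex hd _)).2⟩
  kick j _ := by
    obtain ⟨_, -, hflight⟩ := ho.exists_eq_of_bounceCount_eq_succ hd j
    have hafter : bounceCount N q (bounceIndex N q j + 1) = j + 1 :=
      (ho.bounceCount_eq_succ_iff hd).2
        ⟨Nat.lt_succ_self _, ho.bounceIndex_strictMono hd j.lt_succ_self⟩
    obtain ⟨ν, hν, c, hc, hp⟩ := ho.kick _ (ho.norm_bounceIndex hd j)
    rw [(hflight _ hafter).1] at hp
    exact ⟨ν, hν, c, hc, hp⟩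
  free j hj := (hj (ho.norm_bounceIndex hd j)).elim
  norm_q := ho.norm_bounceIndex hd
  norm_p j := (ho.norm_p_eq _).trans hp

theorem isCentrallySymmetric_comp_bounceIndex (hr : IsRigid n N N') :
    IsCentrallySymmetric n (q ∘ bounceIndex N q) (p ∘ bounceIndex N q) (τ ∘ bounceIndex N q) T := by
  obtain ⟨v, hv, -⟩ := ho.move 0
  have hpos : 0 < (N' (p 0))⁻¹ := inv_pos.2 (ho.energy 0 ▸ hv.pos hd.symm)
  have hunit : N' (((N' (p 0))⁻¹ • p) 0) = 1 := by
    rw [Pi.smul_apply, map_smul_eq_mul, Real.norm_of_nonneg hpos.le,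
      inv_mul_cancel₀ (inv_pos.1 hpos).ne']
  obtain ⟨hq, hp, hτ, hT⟩ := hr _ _ _ _ _
    ((ho.smul_momentum hpos).isBounceOrbit_comp_bounceIndex hd hunit)
  exact ⟨hq, fun j => smul_right_injective _ hpos.ne' ((hp j).trans (smul_neg _ _).symm), hτ, hT⟩

theorem exists_time_add_two (hr : IsRigid n N N') {i : ℕ} (hi : N (q i) = 1) :
    ∃ j, τ j = τ i + 2 := by
  have h := (ho.isCentrallySymmetric_comp_bounceIndex hd hr).time_add (bounceCount N q i)
  simp only [comp_apply, bounceIndex_bounceCount hi] at h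
  exact ⟨_, h⟩

theorem eq_neg_of_bounceCount_eq_succ (hr : IsRigid n N N') {i j b : ℕ}
    (hij : τ j = τ i + 2) (hb : bounceCount N q i = b + 1) :
    q j = -q i ∧ p j = -p i ∧ bounceCount N q j = bounceCount N q i + n := by
  obtain ⟨hq, hp, hτ, -⟩ := ho.isCentrallySymmetric_comp_bounceIndex hd hr
  simp only [Antiperiodic, comp_apply] at hq hp hτ
  obtain ⟨hbi, hib⟩ := (ho.bounceCount_eq_succ_iff hd).1 hb
  have hcount : bounceCount N q j = b + n + 1 := by
    refine (ho.bounceCount_eq_succ_iff hd).2 ⟨?_, ?_⟩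
    · rw [← ho.strictMono.lt_iff_lt, hτ, hij]
      gcongr
      exact ho.strictMono hbi
    · rw [← ho.strictMono.le_iff_le, add_right_comm, hτ, hij]
      gcongr
      exact ho.strictMono.monotone hib
  obtain ⟨v, hv, hflight⟩ := ho.exists_eq_of_bounceCount_eq_succ hd b
  obtain ⟨w, hw, hflight'⟩ := ho.exists_eq_of_bounceCount_eq_succ hd (b + n)
  rw [add_right_comm, hp] at hw hflight'
  obtain rfl := hw.eq hv.neg
  obtain ⟨hpi, hqi⟩ := hflight i hb
  obtain ⟨hpj, hqj⟩ := hflight' j (by rw [hcount, add_right_comm])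
  refine ⟨?_, by rw [hpj, hpi], by rw [hcount, hb, add_right_comm]⟩
  rw [hqj, hqi, hq, hτ, hij]
  module

theorem eq_neg_of_time_add_two (hr : IsRigid n N N') {i j : ℕ} (hij : τ j = τ i + 2) :
    q j = -q i ∧ p j = -p i ∧ bounceCount N q j = bounceCount N q i + n := by
  obtain ⟨b, hb⟩ := Nat.exists_eq_add_one.2
    (Nat.add_pos_right (bounceCount N q i) (ho.bounceCount_period_pos hd))
  rw [← bounceCount_add_period ho.periodic_q] at hb
  have h := ho.eq_neg_of_bounceCount_eq_succ hd hr (j := j + m) (i := i + m)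
    (by rw [ho.time_add_period, ho.time_add_period, hij, add_right_comm]) hb
  simpa only [ho.periodic_q _, ho.periodic_p _, bounceCount_add_period ho.periodic_q,
    add_right_comm _ (bounceCount N q m) n, add_left_inj] using h

end IsBilliardOrbit

end Orbits

section Base

variable {E : Type*} [NormedAddCommGroup E] [InnerProductSpace ℝ E]

theorem isDualPair_normSeminorm [Nontrivial E] :
    IsDualPair (normSeminorm ℝ E) (normSeminorm ℝ E) := by
  have exists_inner_eq : ∀ q : E, ∃ p : E, ‖p‖ ≤ 1 ∧ inner ℝ p q = ‖q‖ := fun q => by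
    rcases eq_or_ne q 0 with rfl | hq
    · exact ⟨0, by simp, by simp⟩
    · refine ⟨‖q‖⁻¹ • q, (norm_smul_inv_norm (𝕜 := ℝ) hq).le, ?_⟩
      rw [real_inner_smul_left, real_inner_self_eq_norm_mul_norm,
        inv_mul_cancel_left₀ (norm_ne_zero_iff.2 hq)]
  exact ⟨inferInstance, real_inner_le_norm, exists_inner_eq, exists_inner_eq⟩

theorem eq_or_eq_neg_of_norm_eq (hE : Module.finrank ℝ E = 1) {x y : E} (hxy : ‖x‖ = ‖y‖) :
    y = x ∨ y = -x := by
  rcases eq_or_ne x 0 with rfl | hx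
  · exact .inl (norm_eq_zero.1 (hxy.symm.trans norm_zero))
  · obtain ⟨c, rfl⟩ := exists_smul_eq_of_finrank_eq_one hE hx y
    rw [norm_smul, eq_comm, mul_eq_right₀ (norm_ne_zero_iff.2 hx), Real.norm_eq_abs] at hxy
    rcases eq_or_eq_neg_of_abs_eq hxy with rfl | rfl <;> simp

theorem eq_neg_of_sub_eq_smul (hE : Module.finrank ℝ E = 1) {x y w : E} {c : ℝ} (hx : ‖x‖ = 1)
    (hy : ‖y‖ = 1) (hw : ‖w‖ = 1) (hc : 0 < c) (hxy : y - x = c • w) : y = -x ∧ c = 2 := by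
  have hnorm : ‖y - x‖ = c := by rw [hxy, norm_smul, hw, mul_one, Real.norm_of_nonneg hc.le]
  rcases eq_or_eq_neg_of_norm_eq hE (hx.trans hy.symm) with rfl | rfl
  · exact (hc.ne (by rw [← hnorm, sub_self, norm_zero])).elim
  · refine ⟨rfl, ?_⟩
    rw [← hnorm, ← neg_add', norm_neg, ← two_smul ℝ x, norm_smul, hx, mul_one]
    norm_num

theorem isRigid_normSeminorm (hE : Module.finrank ℝ E = 1) :
    IsRigid 1 (normSeminorm ℝ E) (normSeminorm ℝ E) := by
  intro q p τ m T ho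
  have := Module.nontrivial_of_finrank_eq_succ hE
  have hd := isDualPair_normSeminorm (E := E)
  have hflight : ∀ i, q (i + 1) = -q i ∧ τ (i + 1) - τ i = 2 := fun i => by
    obtain ⟨v, hv, hq⟩ := ho.move i
    exact eq_neg_of_sub_eq_smul hE (ho.norm_q _) (ho.norm_q _) (hv.eq_one hd)
      (sub_pos.2 (ho.strictMono i.lt_succ_self)) hq
  have hp : Antiperiodic p 1 := fun i => by
    obtain ⟨ν, hν, c, hc, hp⟩ := ho.kick i (ho.norm_q i)
    exact (eq_neg_of_sub_eq_smul hE (ho.norm_p _) (ho.norm_p _) (hν.neg.eq_one hd) hc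
      (hp.trans (smul_neg c ν).symm)).1
  have hq : Antiperiodic q 1 := fun i => (hflight i).1
  have hτ : ∀ i, τ (i + 1) = τ i + 2 := fun i => sub_eq_iff_eq_add'.1 (hflight i).2
  refine ⟨hq, hp, hτ, ?_⟩
  have hT : τ (0 + m • 1) = τ 0 + m • 2 :=
    AddConstMapClass.map_add_nsmul (⟨τ, hτ⟩ : ℕ →+c[1, 2] ℝ) 0 m
  obtain ⟨r, rfl | rfl⟩ := m.even_or_odd'
  · refine ⟨r, ?_⟩
    rw [smul_eq_mul, mul_one, ho.time_add_period, add_right_inj] at hT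
    rw [hT, nsmul_eq_mul]
    push_cast
    ring
  · have hq_zero := (hq.odd_nsmul_antiperiodic r 0).symm.trans
      (by rw [smul_eq_mul, mul_one, ho.periodic_q])
    have : IsAddTorsionFree E := .of_isTorsionFree ℝ E
    have hnorm := ho.norm_q 0
    rw [self_eq_neg.1 hq_zero.symm, map_zero] at hnorm
    exact (zero_ne_one hnorm).elim

end Base

section Sums

variable {G E F : Type*} [NormedAddCommGroup G] [InnerProductSpace ℝ G] [NormedAddCommGroup E]
  [InnerProductSpace ℝ E] [NormedAddCommGroup F] [InnerProductSpace ℝ F]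
  (e : G ≃ₗᵢ[ℝ] WithLp 2 (E × F)) {N N' : Seminorm ℝ E} {M M' : Seminorm ℝ F}

/-- The `ℓ₁`-sum of seminorms on the summands of an orthogonal decomposition `e`. -/
def sumSeminorm (N : Seminorm ℝ E) (M : Seminorm ℝ F) : Seminorm ℝ G :=
  (N.comp (WithLp.fstₗ 2 ℝ E F) + M.comp (WithLp.sndₗ 2 ℝ E F)).comp e.toLinearMap

/-- The `ℓ_∞`-sum of seminorms on the summands of an orthogonal decomposition `e`. -/
def maxSeminorm (N : Seminorm ℝ E) (M : Seminorm ℝ F) : Seminorm ℝ G :=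
  (N.comp (WithLp.fstₗ 2 ℝ E F) ⊔ M.comp (WithLp.sndₗ 2 ℝ E F)).comp e.toLinearMap

theorem sumSeminorm_apply (x : G) : sumSeminorm e N M x = N (e x).fst + M (e x).snd := rfl

theorem maxSeminorm_apply (x : G) : maxSeminorm e N M x = max (N (e x).fst) (M (e x).snd) := rfl

theorem sumSeminorm_comm :
    sumSeminorm (e.trans (.withLpProdComm 2 ℝ E F)) M N = sumSeminorm e N M :=
  Seminorm.ext fun _ => add_comm _ _

theorem maxSeminorm_comm :
    maxSeminorm (e.trans (.withLpProdComm 2 ℝ E F)) M N = maxSeminorm e N M :=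
  Seminorm.ext fun _ => max_comm _ _

theorem inner_eq_add_inner (x y : G) :
    inner ℝ x y = inner ℝ (e x).fst (e y).fst + inner ℝ (e x).snd (e y).snd :=
  (e.inner_map_map x y).symm

theorem ext_fst_snd {x y : G} (hfst : (e x).fst = (e y).fst) (hsnd : (e x).snd = (e y).snd) :
    x = y :=
  e.injective ((WithLp.ofLp_injective 2) (Prod.ext hfst hsnd))

theorem IsDualPair.max (hN : IsDualPair N N') (hM : IsDualPair M M') :
    IsDualPair (maxSeminorm e N M) (sumSeminorm e N' M') where
  nontrivial := by
    have := hN.nontrivial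
    have : Nontrivial (WithLp 2 (E × F)) := (WithLp.equiv 2 (E × F)).nontrivial
    exact e.toEquiv.nontrivial
  inner_le p q := by
    rw [inner_eq_add_inner e, sumSeminorm_apply, maxSeminorm_apply, add_mul]
    refine add_le_add ((hN.inner_le _ _).trans ?_) ((hM.inner_le _ _).trans ?_)
    · exact mul_le_mul_of_nonneg_left (le_max_left _ _) (apply_nonneg _ _)
    · exact mul_le_mul_of_nonneg_left (le_max_right _ _) (apply_nonneg _ _)
  exists_inner_eq q := by
    rcases le_total (M (e q).snd) (N (e q).fst) with h | h
    · obtain ⟨p, hp, hpq⟩ := hN.exists_inner_eq (e q).fst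
      exact ⟨e.symm (.toLp 2 (p, 0)), by simpa [sumSeminorm_apply] using hp,
        by simp [inner_eq_add_inner e, maxSeminorm_apply, hpq, h]⟩
    · obtain ⟨p, hp, hpq⟩ := hM.exists_inner_eq (e q).snd
      exact ⟨e.symm (.toLp 2 (0, p)), by simpa [sumSeminorm_apply] using hp,
        by simp [inner_eq_add_inner e, maxSeminorm_apply, hpq, h]⟩
  exists_inner_eq' p := by
    obtain ⟨x, hx, hxp⟩ := hN.exists_inner_eq' (e p).fst
    obtain ⟨y, hy, hyp⟩ := hM.exists_inner_eq' (e p).snd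
    exact ⟨e.symm (.toLp 2 (x, y)), by simp [maxSeminorm_apply, hx, hy],
      by simp [inner_eq_add_inner e, sumSeminorm_apply, hxp, hyp]⟩

namespace IsNormal

theorem fst_of_sum (hN : IsDualPair N N') (hM : IsDualPair M M') {q ν : G}
    (h : IsNormal (sumSeminorm e N M) (maxSeminorm e N' M') q ν) :
    IsNormal N N' (e q).fst (e ν).fst := by
  obtain ⟨hν_fst, hν_snd⟩ : N' (e ν).fst ≤ 1 ∧ M' (e ν).snd ≤ 1 := max_le_iff.1 h.le_one
  have hq := h.inner_eq
  rw [sumSeminorm_apply, inner_eq_add_inner e] at hq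
  have hfst := hN.inner_le_of_le_one hν_fst (e q).fst
  have hsnd := hM.inner_le_of_le_one hν_snd (e q).snd
  refine ⟨hν_fst, by linarith, fun g hg hgq => ?_⟩
  rw [← h.unique (e.symm (.toLp 2 (g, (e ν).snd)))]
  · simp
  · simpa [maxSeminorm_apply] using ⟨hg, hν_snd⟩
  · simp only [inner_eq_add_inner e, sumSeminorm_apply, e.apply_symm_apply, WithLp.toLp_fst,
      WithLp.toLp_snd]
    linarith

theorem fst_of_max (hN : IsDualPair N N') {q ν : G}
    (h : IsNormal (maxSeminorm e N M) (sumSeminorm e N' M') q ν)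
    (hle : M (e q).snd ≤ N (e q).fst) :
    IsNormal N N' (e q).fst (e ν).fst ∧ (e ν).snd = 0 := by
  obtain ⟨g, hg, rfl⟩ := h.exists_eq_of_injective hN (f := fun g => e.symm (.toLp 2 (g, 0)))
    (e.symm.injective.comp ((WithLp.toLp_injective 2).comp (Prod.mk_left_injective 0)))
    (fun g hg => by simpa [sumSeminorm_apply] using hg)
    (fun g => by simp [inner_eq_add_inner e]) (max_eq_left hle).symm
  simpa using hg

theorem snd_lt_fst_of_max (hN : IsDualPair N N') (hM : IsDualPair M M') {q ν : G}
    (h : IsNormal (maxSeminorm e N M) (sumSeminorm e N' M') q ν)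
    (hle : M (e q).snd ≤ N (e q).fst) : M (e q).snd < N (e q).fst := by
  refine hle.lt_of_not_ge fun hge => ?_
  have h_swap := h
  rw [← maxSeminorm_comm, ← sumSeminorm_comm] at h_swap
  exact (h_swap.fst_of_max _ hM hge).1.ne_zero hM (h.fst_of_max e hN hle).2

end IsNormal

namespace IsBounceOrbit

variable {q p : ℕ → G} {τ : ℕ → ℝ} {m : ℕ} {T : ℝ}

theorem kick_fst (hN : IsDualPair N N') (hM : IsDualPair M M')
    (ho : IsBounceOrbit (maxSeminorm e N M) (sumSeminorm e N' M') q p τ m T) {i : ℕ}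
    (hi : N (e (q i)).fst = 1) :
    M (e (q i)).snd ≠ 1 ∧ (∃ ν, IsNormal N N' (e (q i)).fst ν ∧
      ∃ c : ℝ, 0 < c ∧ (e (p (i + 1))).fst - (e (p i)).fst = -(c • ν)) ∧
      (e (p (i + 1))).snd = (e (p i)).snd := by
  obtain ⟨ν, hν, c, hc, hp⟩ := ho.kick i (ho.norm_q i)
  have hle : M (e (q i)).snd ≤ N (e (q i)).fst := by
    rw [hi, ← ho.norm_q i]
    exact le_max_right _ _
  obtain ⟨hfst, hsnd⟩ := hν.fst_of_max e hN hle
  replace hp := congrArg e hp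
  simp only [map_sub, map_neg, map_smul] at hp
  refine ⟨(hi ▸ hν.snd_lt_fst_of_max e hN hM hle).ne, ⟨_, hfst, c, hc, ?_⟩, ?_⟩
  · exact congrArg WithLp.fst hp
  · have hp_snd := congrArg WithLp.snd hp
    simpa [hsnd, sub_eq_zero] using hp_snd

theorem comm (ho : IsBounceOrbit (maxSeminorm e N M) (sumSeminorm e N' M') q p τ m T) :
    IsBounceOrbit (maxSeminorm (e.trans (.withLpProdComm 2 ℝ E F)) M N)
      (sumSeminorm (e.trans (.withLpProdComm 2 ℝ E F)) M' N') q p τ m T := by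
  rwa [maxSeminorm_comm, sumSeminorm_comm]

theorem norm_snd_eq_one (ho : IsBounceOrbit (maxSeminorm e N M) (sumSeminorm e N' M') q p τ m T)
    {i : ℕ} (hi : N (e (q i)).fst ≠ 1) : M (e (q i)).snd = 1 := by
  have hq := ho.norm_q i
  rw [maxSeminorm_apply, max_eq_iff] at hq
  exact hq.elim (fun h => (hi h.1).elim) And.left

theorem fst (hN : IsDualPair N N') (hM : IsDualPair M M')
    (ho : IsBounceOrbit (maxSeminorm e N M) (sumSeminorm e N' M') q p τ m T) :
    IsBilliardOrbit N N' (fun i => (e (q i)).fst) (fun i => (e (p i)).fst) τ m T := by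
  have hfree : ∀ i, N (e (q i)).fst ≠ 1 → (e (p (i + 1))).fst = (e (p i)).fst := fun i hi =>
    ((ho.comm e).kick_fst _ hM hN (ho.norm_snd_eq_one e hi)).2.2
  refine ⟨ho.strictMono, ho.period_pos, ho.periodic_q.comp fun x => (e x).fst,
    ho.periodic_p.comp fun x => (e x).fst, ho.time_add_period, fun i => ?_, fun i => ?_,
    fun i hi => (ho.kick_fst e hN hM hi).2.1, hfree⟩
  · by_cases hi : N (e (q i)).fst = 1
    · have henergy := ho.energy i
      rwa [sumSeminorm_apply, sumSeminorm_apply, (ho.kick_fst e hN hM hi).2.2, add_left_inj]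
        at henergy
    · rw [hfree i hi]
  · obtain ⟨v, hv, hq⟩ := ho.move i
    refine ⟨(e v).fst, hv.fst_of_sum e hN.symm hM.symm, ?_⟩
    simpa using congrArg (fun x => (e x).fst) hq

theorem bounceCount_fst_add_bounceCount_snd (hN : IsDualPair N N') (hM : IsDualPair M M')
    (ho : IsBounceOrbit (maxSeminorm e N M) (sumSeminorm e N' M') q p τ m T) (i : ℕ) :
    bounceCount N (fun i => (e (q i)).fst) i + bounceCount M (fun i => (e (q i)).snd) i = i := by
  induction i with
  | zero => rfl
  | succ i ih =>
    rw [bounceCount_succ, bounceCount_succ]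
    by_cases hi : N (e (q i)).fst = 1
    · rw [if_pos hi, if_neg (ho.kick_fst e hN hM hi).1]
      lia
    · rw [if_neg hi, if_pos (ho.norm_snd_eq_one e hi)]
      lia

end IsBounceOrbit

namespace IsRigid

variable {k l : ℕ}

/-- Each summand moves freely while the other one bounces, so it is a billiard orbit with the clock
of the sum. Hence both summands are reflected in the origin after the same time `2`. -/
theorem max (hN : IsDualPair N N') (hM : IsDualPair M M') (hrN : IsRigid k N N')
    (hrM : IsRigid l M M') : IsRigid (k + l) (maxSeminorm e N M) (sumSeminorm e N' M') := by
  intro q p τ m T ho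
  have ho_fst := ho.fst e hN hM
  have ho_snd : IsBilliardOrbit M M' (fun i => (e (q i)).snd) (fun i => (e (p i)).snd) τ m T :=
    (ho.comm e).fst _ hM hN
  have hneg : ∀ i j, τ j = τ i + 2 → q j = -q i ∧ p j = -p i ∧ j = i + (k + l) := fun i j hij => by
    obtain ⟨hq_fst, hp_fst, hcount_fst⟩ := ho_fst.eq_neg_of_time_add_two hN hrN hij
    obtain ⟨hq_snd, hp_snd, hcount_snd⟩ := ho_snd.eq_neg_of_time_add_two hM hrM hij
    refine ⟨ext_fst_snd e (by simpa using hq_fst) (by simpa using hq_snd),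
      ext_fst_snd e (by simpa using hp_fst) (by simpa using hp_snd), ?_⟩
    have hi := ho.bounceCount_fst_add_bounceCount_snd e hN hM i
    have hj := ho.bounceCount_fst_add_bounceCount_snd e hN hM j
    lia
  have htime : ∀ i, τ (i + (k + l)) = τ i + 2 := fun i => by
    obtain ⟨j, hij⟩ : ∃ j, τ j = τ i + 2 := by
      by_cases hi : N (e (q i)).fst = 1
      · exact ho_fst.exists_time_add_two hN hrN hi
      · exact ho_snd.exists_time_add_two hM hrM (ho.norm_snd_eq_one e hi)
    rwa [← (hneg i j hij).2.2]
  exact ⟨fun i => (hneg _ _ (htime i)).1, fun i => (hneg _ _ (htime i)).2.1, htime,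
    (ho_fst.isCentrallySymmetric_comp_bounceIndex hN hrN).exists_period_eq⟩

theorem sum (hN : IsDualPair N N') (hM : IsDualPair M M') (hrN : IsRigid k N N')
    (hrM : IsRigid l M M') : IsRigid (k + l) (sumSeminorm e N M) (maxSeminorm e N' M') :=
  (hrN.symm.max e hN.symm hM.symm hrM.symm).symm

end IsRigid

end Sums

section Bodies

variable {n k l : ℕ} {N N' : Seminorm ℝ (Space n)}

theorem gauge_unitBall {E : Type*} [AddCommGroup E] [Module ℝ E] (N : Seminorm ℝ E) :
    gauge {x | N x ≤ 1} = N := by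
  refine le_antisymm ?_ fun x => le_of_forall_gt_imp_ge_of_dense fun r hr => ?_
  · exact (gauge_mono (N.absorbent_ball_zero one_pos)
      fun x hx => (N.mem_ball_zero.1 hx).le).trans_eq N.gauge_ball
  · have habsorbent : Absorbent ℝ {x | N x ≤ 1} := by
      rw [← N.closedBall_zero_eq]
      exact N.absorbent_closedBall_zero one_pos
    obtain ⟨b, hb, hbr, y, hy, rfl⟩ := exists_lt_of_gauge_lt habsorbent hr
    rw [map_smul_eq_mul, Real.norm_of_nonneg hb.le]
    exact (mul_le_of_le_one_right hb.le hy).trans hbr.le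

/-- The decomposition `ℝᵏ⁺ˡ = ℝᵏ ⊕ ℝˡ`. -/
noncomputable def splitIsometry (k l : ℕ) : Space (k + l) ≃ₗᵢ[ℝ] WithLp 2 (Space k × Space l) :=
  LinearEquiv.isometryOfInner
    { toFun x := .toLp 2 (firstPart x, lastPart x)
      map_add' _ _ := rfl
      map_smul' _ _ := rfl
      invFun y := .toLp 2 (Fin.append y.fst y.snd)
      left_inv x := by
        ext i
        refine Fin.addCases (fun j => ?_) (fun j => ?_) i <;> simp [firstPart, lastPart]
      right_inv y := by
        refine (WithLp.ofLp_injective 2) (Prod.ext ?_ ?_) <;> ext i <;>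
          simp [firstPart, lastPart] }
    fun x y => by simp [PiLp.inner_apply, Fin.sum_univ_add, firstPart, lastPart]

theorem sumOne_unitBall (N : Seminorm ℝ (Space k)) (M : Seminorm ℝ (Space l)) :
    sumOne {x | N x ≤ 1} {y | M y ≤ 1} = {x | sumSeminorm (splitIsometry k l) N M x ≤ 1} := by
  rw [sumOne, gauge_unitBall, gauge_unitBall]
  rfl

theorem sumInfty_unitBall (N : Seminorm ℝ (Space k)) (M : Seminorm ℝ (Space l)) :
    sumInfty {x | N x ≤ 1} {y | M y ≤ 1} = {x | maxSeminorm (splitIsometry k l) N M x ≤ 1} := by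
  rw [sumInfty, gauge_unitBall, gauge_unitBall]
  rfl

theorem IsHanner.exists_isRigid {H : Set (Space n)} (hH : IsHanner H) :
    ∃ N N' : Seminorm ℝ (Space n), IsDualPair N N' ∧ H = {x | N x ≤ 1} ∧ IsRigid n N N' := by
  induction hH with
  | segment =>
    refine ⟨_, _, isDualPair_normSeminorm, ?_, isRigid_normSeminorm finrank_euclideanSpace_fin⟩
    ext x
    simp [EuclideanSpace.norm_eq, Real.sqrt_sq_eq_abs, abs_le]
  | sumOne _ _ ihK ihL =>
    obtain ⟨N, N', hN, rfl, hrN⟩ := ihK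
    obtain ⟨M, M', hM, rfl, hrM⟩ := ihL
    exact ⟨_, _, (hN.symm.max _ hM.symm).symm, sumOne_unitBall N M, hrN.sum _ hN hM hrM⟩
  | sumInfty _ _ ihK ihL =>
    obtain ⟨N, N', hN, rfl, hrN⟩ := ihK
    obtain ⟨M, M', hM, rfl, hrM⟩ := ihL
    exact ⟨_, _, hN.max _ hM, sumInfty_unitBall N M, hrN.max _ hN hM hrM⟩

namespace IsDualPair

theorem polarBody_unitBall (h : IsDualPair N N') :
    polarBody {x | N x ≤ 1} = {p | N' p ≤ 1} := by
  refine Set.Subset.antisymm (fun p hp => ?_)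
    fun p hp q hq => (h.inner_le_of_le_one hp q).trans hq
  obtain ⟨q, hq, hqp⟩ := h.exists_inner_eq' p
  rw [Set.mem_ofPred_eq, ← hqp, real_inner_comm]
  exact hp q hq

theorem bodyNorm_unitBall (h : IsDualPair N N') : bodyNorm {p | N' p ≤ 1} = N := by
  ext q
  refine IsGreatest.csSup_eq ⟨h.exists_inner_eq q, ?_⟩
  rintro _ ⟨p, hp, rfl⟩
  exact h.inner_le_of_le_one hp q

theorem isNormal_of_isSmoothBoundaryPoint (h : IsDualPair N N') {q ν : Space n}
    (hq : IsSmoothBoundaryPointWithNormal {x | N x ≤ 1} q ν) : N q = 1 ∧ IsNormal N N' q ν := by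
  obtain ⟨hfrontier, hν⟩ := hq
  rw [h.polarBody_unitBall, h.bodyNorm_unitBall] at hν
  have hcont : Continuous N := continuousOn_univ.1 (N.convexOn.continuousOn isOpen_univ)
  exact ⟨frontier_le_subset_eq hcont continuous_const hfrontier, h.isNormal_of_hasGradientAt hν⟩

end IsDualPair

end Bodies

section Trajectories

variable {n m : ℕ} [NeZero m] {N N' : Seminorm ℝ (Space n)} {q p : ZMod m → Space n}

theorem sum_range_natCast {M : Type*} [AddCommMonoid M] (f : ZMod m → M) :
    ∑ j ∈ Finset.range m, f j = ∑ i, f i :=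
  Finset.sum_nbij' (fun j => (j : ZMod m)) ZMod.val (fun _ _ => Finset.mem_univ _)
    (fun i _ => Finset.mem_range.2 (ZMod.val_lt i))
    (fun _ hj => ZMod.val_cast_of_lt (Finset.mem_range.1 hj))
    (fun i _ => ZMod.natCast_zmod_val i) fun _ _ => rfl

theorem IsClassicalTrajectory.isBounceOrbit (hd : IsDualPair N N')
    (ht : IsClassicalTrajectory {x | N x ≤ 1} {x | N' x ≤ 1} q p) :
    IsBounceOrbit N N' (fun i : ℕ => q i) (fun i : ℕ => p i)
      (fun i => ∑ j ∈ Finset.range i, N (q (j + 1) - q j)) m (∑ i, N (q (i + 1) - q i)) := by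
  have hmove : ∀ i : ZMod m, N' (p (i + 1)) = 1 ∧ ∃ v, IsNormal N' N (p (i + 1)) v ∧
      0 < N (q (i + 1) - q i) ∧ q (i + 1) - q i = N (q (i + 1) - q i) • v := fun i => by
    obtain ⟨v, hv, c, hc, hq⟩ := ht.coordinate_step i
    obtain ⟨hp, hv⟩ := hd.symm.isNormal_of_isSmoothBoundaryPoint hv
    have hnorm : N (q (i + 1) - q i) = c := by
      rw [hq, map_smul_eq_mul, Real.norm_of_nonneg hc.le, hv.eq_one hd.symm, mul_one]
    exact ⟨hp, v, hv, hnorm.symm ▸ hc, hnorm.symm ▸ hq⟩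
  have hkick : ∀ i : ZMod m, N (q i) = 1 ∧ ∃ ν, IsNormal N N' (q i) ν ∧
      ∃ c : ℝ, 0 < c ∧ p (i + 1) - p i = -(c • ν) := fun i => by
    obtain ⟨ν, hν, hp⟩ := ht.momentum_step i
    obtain ⟨hq, hν⟩ := hd.isNormal_of_isSmoothBoundaryPoint hν
    exact ⟨hq, ν, hν, hp⟩
  have hnorm_p : ∀ i, N' (p i) = 1 := fun i => sub_add_cancel i 1 ▸ (hmove (i - 1)).1
  refine ⟨⟨strictMono_nat_of_lt_succ fun i => ?_, NeZero.pos m, fun i => by simp,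
    fun i => by simp, fun i => ?_, fun i => by rw [hnorm_p, hnorm_p], fun i => ?_, fun i _ => ?_,
    fun i hi => (hi (hkick i).1).elim⟩, fun i => (hkick i).1, fun i => hnorm_p i⟩
  · obtain ⟨-, -, -, hpos, -⟩ := hmove i
    rwa [Finset.sum_range_succ, lt_add_iff_pos_right]
  · rw [← sum_range_natCast, add_comm i, Finset.sum_range_add, add_comm]
    simp
  · obtain ⟨-, v, hv, -, hq⟩ := hmove i
    rw [Finset.sum_range_succ, add_sub_cancel_left, Nat.cast_succ]
    exact ⟨v, hv, hq⟩
  · rw [Nat.cast_succ]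
    exact (hkick i).2

/-- The number `r` tells how many times the trajectory passes its route. -/
theorem IsHanner.exists_trajectoryLength_eq_mul {H : Set (Space n)} (hH : IsHanner H)
    (ht : IsClassicalTrajectory H (polarBody H) q p) :
    Antiperiodic q n ∧ Antiperiodic p n ∧
      ∃ r : ℕ, m = 2 * n * r ∧ trajectoryLength (polarBody H) q = 4 * r := by
  obtain ⟨N, N', hd, rfl, hr⟩ := hH.exists_isRigid
  rw [hd.polarBody_unitBall] at ht ⊢
  have ho := ht.isBounceOrbit hd
  have hs := hr _ _ _ _ _ ho
  rw [trajectoryLength, hd.bodyNorm_unitBall]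
  refine ⟨fun i => ?_, fun i => ?_, ho.exists_eq_mul hs⟩
  · simpa using hs.antiperiodic_q i.val
  · simpa using hs.antiperiodic_p i.val

end Trajectories

end HannerBilliard

theorem mainTheorem1 (n : ℕ) (H : Set (HannerBilliard.Space n)) (hH : HannerBilliard.IsHanner H)
    (m : ℕ) [NeZero m] (q p : ZMod m → HannerBilliard.Space n)
    (htraj : HannerBilliard.IsClassicalTrajectory H (HannerBilliard.polarBody H) q p)
    (hsimple : HannerBilliard.IsSimpleTrajectory q p) :
    HannerBilliard.trajectoryLength (HannerBilliard.polarBody H) q = 4 ∧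
      m = 2 * n ∧
      (∀ i : ZMod m, q i = -q (i + (n : ZMod m))) ∧
      (∀ i : ZMod m, p i = -p (i + (n : ZMod m))) := by
  obtain ⟨hq, hp, r, hm, hT⟩ := hH.exists_trajectoryLength_eq_mul htraj
  have hdvd : m ∣ 2 * n := by
    rw [← ZMod.natCast_eq_zero_iff, Nat.cast_mul, Nat.cast_two]
    exact hsimple _ fun i => ⟨hq.periodic_two_mul i, hp.periodic_two_mul i⟩
  have hm_eq : m = 2 * n := hdvd.antisymm ⟨r, hm⟩
  have hr : r = 1 := Nat.eq_of_mul_eq_mul_left (NeZero.pos m) (by rw [mul_one, hm_eq, ← hm, hm_eq])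
  exact ⟨by rw [hT, hr, Nat.cast_one, mul_one], hm_eq, fun i => by rw [hq, neg_neg],
    fun i => by rw [hp, neg_neg]⟩
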